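/- Let $X$ be a measurable space, $Y\subseteq\mathbb R$, $\rho$ a probability measure on $X\times Y$, $V:\mathbb R\times\mathbb R\to[0,\infty)$ a measurable loss, and $\Phi:X\to\mathcal F$ a measurable map into a real separable Hilbert space. For $w\in\mathcal F$ put $\mathcal E(w)=\int V(y,\langle w,\Phi(x)\rangle)\,d\rho(x,y)$. Assume: (1) $\kappa=\sup_{x\in X}\|\Phi(x)\|<\infty$; for every $y\in Y$ the function $V(y,\cdot)$ is convex; $\sup_{y\in Y}V(y,0)<\infty$; and the left-hand derivative satisfies $|V'_-(y,a)|\le a_0$ for all $y\in Y$, $a\in\mathbb R$; (2) for some $\beta\in(0,1]$ and $c_\beta>0$, for all $\lambda>0$, $$\inf_{w\in\mathcal F}\Big\{\mathcal E(w)+\tfrac{\lambda}{2}\|w\|^2\Big\}-\inf_{w\in\mathcal F}\mathcal E(w)\le c_\beta\lambda^\beta;$$ (3) for every $y\in Y$, $V(y,\cdot)$ is differentiable and its derivative is Lipschitz with constant $L>0$. Given $m\ge 1$, let $z_i=(x_i,y_i)$, $i=1,\dots,m$, be drawn independently from $\rho$, and let $j_1,j_2,\dots$ be independent and uniform on $\{1,\dots,m\}$,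 independent of the sample. Let $\eta_t=\eta_1/\sqrt m$ for all $t$, where $\eta_1>0$ is a constant with $\eta_1\kappa^2L\le 2$. Define $w_1=0$ and $$w_{t+1}=w_t-\eta_t\,V'_-(y_{j_t},\langle w_t,\Phi(x_{j_t})\rangle)\,\Phi(x_{j_t}),\qquad t\ge1,$$ and $\overline w_t=\sum_{k=1}^t\eta_kw_k\big/\sum_{k=1}^t\eta_k$. Then there is a constant $C>0$, depending only on $\kappa,a_0,c_\beta,\beta,\eta_1$, such that for $g_t=\overline w_t$ and for $g_t=w_t$, the following expectations (over the sample and the indices) exist and satisfy, for all $m\ge1$ and $t\ge1$, $$\mathbb E\Big[\mathcal E(g_t)-\inf_{w\in\mathcal F}\mathcal E(w)\Big]\le C\left(\frac{t\log t}{\sqrt{m^3}}+\frac{\log t}{\sqrt m}+\Big(\frac{\sqrt m}{t}\Big)^{\beta}\right),$$ and, for all $m\ge2$ and $t^*=\big\lceil m^{\frac{\beta+3}{2(\beta+1)}}\big\rceil$, $$\mathbb E\Big[\mathcal E(g_{t^*})-\inf_{w\in\mathcal F}\mathcal E(w)\Big]\le C\,m^{-\frac{\beta}{\beta+1}}\log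 m.$$ -/

import Mathlib

open MeasureTheory ProbabilityTheory
open scoped InnerProductSpace

universe u v

noncomputable section

namespace SGM

/-- Left-hand derivative of a real function at a point. -/
def leftDeriv (f : ℝ → ℝ) (a : ℝ) : ℝ := derivWithin f (Set.Iio a) a

section Setting

variable {X F : Type*} [MeasurableSpace X] [NormedAddCommGroup F] [InnerProductSpace ℝ F]
variable {Y : Set ℝ}

/-- Expected risk `∫ V (y, ⟪w, Φ x⟫) dρ(x, y)` of the linear function with parameter `w`. -/
def risk (ρ : Measure (X × Y)) (V : ℝ → ℝ → ℝ) (Φ : X → F) (w : F) : ℝ :=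
  ∫ p, V p.2 ⟪w, Φ p.1⟫_ℝ ∂ρ

/-- The infimum of the expected risk over the hypothesis space. -/
def infRisk (ρ : Measure (X × Y)) (V : ℝ → ℝ → ℝ) (Φ : X → F) : ℝ :=
  ⨅ w : F, risk ρ V Φ w

/-- The approximation error of the triplet `(ρ, V, Φ)`. -/
def approxError (ρ : Measure (X × Y)) (V : ℝ → ℝ → ℝ) (Φ : X → F) (lam : ℝ) : ℝ :=
  (⨅ w : F, (risk ρ V Φ w + lam / 2 * ‖w‖ ^ 2)) - infRisk ρ V Φ

/-- Boundedness: `κ = sup ‖Φ x‖` is finite, the loss is convex in its second entry,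
`sup V (y, 0)` is finite, and the left-hand derivative of the loss is bounded by `a₀`. -/
structure BoundedAssumption (Y : Set ℝ) (V : ℝ → ℝ → ℝ) (Φ : X → F) (κ a₀ : ℝ) : Prop where
  isLUB_norm : IsLUB (Set.range fun x => ‖Φ x‖) κ
  convex : ∀ y ∈ Y, ConvexOn ℝ Set.univ (V y)
  bddAbove_zero : BddAbove ((fun y => V y 0) '' Y)
  leftDeriv_le : ∀ y ∈ Y, ∀ a, |leftDeriv (V y) a| ≤ a₀

/-- Polynomial decay of the approximation error. -/
structure ApproxAssumption (ρ : Measure (X × Y)) (V : ℝ → ℝ → ℝ) (Φ : X → F) (β c : ℝ) :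
    Prop where
  β_pos : 0 < β
  β_le_one : β ≤ 1
  c_pos : 0 < c
  decay : ∀ lam : ℝ, 0 < lam → approxError ρ V Φ lam ≤ c * lam ^ β

/-- Smoothness: the loss is differentiable in its second entry, with `L`-Lipschitz derivative. -/
structure SmoothAssumption (Y : Set ℝ) (V : ℝ → ℝ → ℝ) (L : ℝ) : Prop where
  L_pos : 0 < L
  differentiable : ∀ y ∈ Y, Differentiable ℝ (V y)
  lipschitz : ∀ y ∈ Y, ∀ a b, |deriv (V y) b - deriv (V y) a| ≤ L * |b - a|

/-- The iterates of the stochastic gradient method on the sample `z`, with step-sizes `η` and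
index sequence `j`. They are numbered from `1`: `w₁ = 0` and
`w_{t+1} = w_t - η_t V'₋(y_{j_t}, ⟪w_t, Φ(x_{j_t})⟫) Φ(x_{j_t})` for `t ≥ 1`.
The value at `0`, and `η 0` and `j 0`, are never used. -/
def iterate (V : ℝ → ℝ → ℝ) (Φ : X → F) (η : ℕ → ℝ) {m : ℕ} (z : Fin m → X × Y)
    (j : ℕ → Fin m) : ℕ → F
  | 0 => 0
  | 1 => 0
  | t + 2 =>
    iterate V Φ η z j (t + 1) -
      (η (t + 1) *
        leftDeriv (V (z (j (t + 1))).2)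
          ⟪iterate V Φ η z j (t + 1), Φ (z (j (t + 1))).1⟫_ℝ) • Φ (z (j (t + 1))).1

/-- The averaged iterates `∑_{k=1}^t η_k w_k / ∑_{k=1}^t η_k`. -/
def avgIterate (V : ℝ → ℝ → ℝ) (Φ : X → F) (η : ℕ → ℝ) {m : ℕ} (z : Fin m → X × Y)
    (j : ℕ → Fin m) (t : ℕ) : F :=
  (∑ k ∈ Finset.Icc 1 t, η k)⁻¹ • ∑ k ∈ Finset.Icc 1 t, η k • iterate V Φ η z j k

/-- The joint law of the sample `z` (`m` independent draws from `ρ`) and the index sequence `j`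
(independent of the sample, with independent entries, uniform on the `m` indices). -/
def law (ρ : Measure (X × Y)) (m : ℕ) [NeZero m] :
    Measure ((Fin m → X × Y) × (ℕ → Fin m)) :=
  (Measure.pi fun _ : Fin m => ρ).prod
    (Measure.infinitePi fun _ : ℕ => (PMF.uniformOfFintype (Fin m)).toMeasure)

/-- The assertion that the expected excess risk of the random parameter `g z j` exists and is at
most `B`. -/
def ExpectedExcessRiskLE (ρ : Measure (X × Y)) (V : ℝ → ℝ → ℝ) (Φ : X → F) (m : ℕ) [NeZero m]
    (g : (Fin m → X × Y) → (ℕ → Fin m) → F) (B : ℝ) : Prop :=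
  Integrable (fun q => risk ρ V Φ (g q.1 q.2) - infRisk ρ V Φ) (law ρ m) ∧
    ∫ q, (risk ρ V Φ (g q.1 q.2) - infRisk ρ V Φ) ∂(law ρ m) ≤ B

end Setting

end SGM

end

/-! Write `G = a₀ * κ`, the Lipschitz constant of the loss in `w`, and let `η` be the constant step.
The expected excess risk splits into three errors. Generalization: smoothness and `η * (κ ^ 2 * L) ≤
2` make each gradient step nonexpansive (`norm_gradStep_sub_gradStep_le`). Replacing one example
therefore moves the iterate only at the steps that draw it, by at most `2 * η * G` each time.
Exchanging that example with a fresh one, then averaging over the examples, bounds expected risk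
minus expected empirical risk by `2 * η * G ^ 2 * k / m` after `k` steps
(`expRisk_le_expEmpRisk_add`). Optimization: `w_k` does not depend on `j_k`, so the squared distance
to a comparison point decreases in expectation by `2 * η` times the empirical excess, up to `(η * G)
^ 2` (`integral_sq_norm_succ_sub_le`). Telescoping against a fixed `w` controls the average iterate.
Telescoping against `w_s` bounds every block of iterates by its first one, and `last_le_average_add`
turns this into a bound on the last iterate, at the cost of a logarithm. Approximation: the distance
term `‖w‖ ^ 2 / (2 * η * t)` is a Tikhonov penalty with parameter `1 / (η * t)`, so the infimum over
`w` produces the approximation error. With `η = η₁ / √m` the sum is at most a constant times `rate`;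
the stated stopping time balances its terms up to logarithms. `L` enters only through
nonexpansiveness, so the constant does not involve it. -/

noncomputable section

namespace SGM

set_option linter.unusedSectionVars false

/-! ### Pathwise properties of gradient steps and iterates -/

section Deterministic

variable {X F : Type*} [MeasurableSpace X] [NormedAddCommGroup F] [InnerProductSpace ℝ F]
variable {Y : Set ℝ} {V : ℝ → ℝ → ℝ} {Φ : X → F} {κ a₀ L η : ℝ} {m : ℕ}

/-- The loss of the linear function with parameter `w` at the example `p`. -/
def loss (V : ℝ → ℝ → ℝ) (Φ : X → F) (w : F) (p : X × Y) : ℝ := V p.2 ⟪w, Φ p.1⟫_ℝ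

/-- The average loss of the parameter `w` over the sample `z`. -/
def empRisk (V : ℝ → ℝ → ℝ) (Φ : X → F) (z : Fin m → X × Y) (w : F) : ℝ :=
  (m : ℝ)⁻¹ * ∑ i, loss V Φ w (z i)

/-- One gradient step of size `η` on the loss at the example `p`. -/
def gradStep (V : ℝ → ℝ → ℝ) (Φ : X → F) (η : ℝ) (w : F) (p : X × Y) : F :=
  w - (η * leftDeriv (V p.2) ⟪w, Φ p.1⟫_ℝ) • Φ p.1

lemma leftDeriv_eq_deriv {f : ℝ → ℝ} {a : ℝ} (h : DifferentiableAt ℝ f a) :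
    leftDeriv f a = deriv f a :=
  h.derivWithin (uniqueDiffWithinAt_Iio a)

lemma sub_le_deriv_mul_sub {f : ℝ → ℝ} (hc : ConvexOn ℝ Set.univ f) (hd : Differentiable ℝ f)
    (a b : ℝ) : f a - f b ≤ deriv f a * (a - b) := by
  rcases lt_trichotomy a b with h | rfl | h
  · have := hc.deriv_le_slope (Set.mem_univ a) (Set.mem_univ b) h (hd a)
    rw [slope_def_field, le_div_iff₀ (by linarith)] at this
    linarith
  · simp
  · have := hc.slope_le_deriv (Set.mem_univ b) (Set.mem_univ a) h (hd a)
    rw [slope_def_field, div_le_iff₀ (by linarith)] at this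
    linarith

namespace BoundedAssumption

variable (hB : BoundedAssumption Y V Φ κ a₀)
include hB

lemma norm_le (x : X) : ‖Φ x‖ ≤ κ := hB.isLUB_norm.1 ⟨x, rfl⟩

lemma kappa_nonneg (x : X) : 0 ≤ κ := (norm_nonneg _).trans (hB.norm_le x)

lemma slope_nonneg (y : Y) : 0 ≤ a₀ := (abs_nonneg _).trans (hB.leftDeriv_le y y.2 0)

end BoundedAssumption

section Steps

variable (hB : BoundedAssumption Y V Φ κ a₀) (hS : SmoothAssumption Y V L)

include hB hS in
lemma sub_le_leftDeriv_mul_sub (y : Y) (a b : ℝ) :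
    V y a - V y b ≤ leftDeriv (V y) a * (a - b) := by
  rw [leftDeriv_eq_deriv (hS.differentiable y y.2 a)]
  exact sub_le_deriv_mul_sub (hB.convex y y.2) (hS.differentiable y y.2) a b

include hB hS in
lemma abs_sub_le (y : Y) (a b : ℝ) : |V y a - V y b| ≤ a₀ * |a - b| := by
  have key : ∀ a b : ℝ, V y a - V y b ≤ a₀ * |a - b| := fun a b =>
    (sub_le_leftDeriv_mul_sub hB hS y a b).trans <| (le_abs_self _).trans <| by
      rw [abs_mul]
      exact mul_le_mul_of_nonneg_right (hB.leftDeriv_le y y.2 a) (abs_nonneg _)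
  refine abs_le.2 ⟨?_, key a b⟩
  have := key b a
  rw [abs_sub_comm] at this
  linarith

include hB hS in
lemma abs_loss_sub_le (w w' : F) (p : X × Y) :
    |loss V Φ w p - loss V Φ w' p| ≤ a₀ * κ * ‖w - w'‖ := by
  refine (abs_sub_le hB hS p.2 _ _).trans ?_
  rw [← inner_sub_left, mul_assoc, mul_comm κ]
  exact mul_le_mul_of_nonneg_left ((abs_real_inner_le_norm _ _).trans
    (mul_le_mul_of_nonneg_left (hB.norm_le _) (norm_nonneg _))) (hB.slope_nonneg p.2)

include hB in
lemma norm_smul_feature_le (hη : 0 ≤ η) (w : F) (p : X × Y) :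
    ‖(η * leftDeriv (V p.2) ⟪w, Φ p.1⟫_ℝ) • Φ p.1‖ ≤ η * (a₀ * κ) := by
  rw [norm_smul, Real.norm_eq_abs, abs_mul, abs_of_nonneg hη, mul_assoc]
  exact mul_le_mul_of_nonneg_left (mul_le_mul (hB.leftDeriv_le _ p.2.2 _) (hB.norm_le _)
    (norm_nonneg _) (hB.slope_nonneg p.2)) hη

include hB in
lemma norm_gradStep_sub_le (hη : 0 ≤ η) (w : F) (p : X × Y) :
    ‖gradStep V Φ η w p - w‖ ≤ η * (a₀ * κ) := by
  rw [gradStep, sub_sub_cancel_left, norm_neg]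
  exact norm_smul_feature_le hB hη w p

-- The two gradients differ by a multiple `D` of the same feature vector. Monotonicity and the
-- Lipschitz bound give cocoercivity, `D ^ 2 ≤ L * (D * (a - b))`, so in the expanded square the
-- quadratic term is absorbed by the cross term exactly when `η * (κ ^ 2 * L) ≤ 2`.
include hB hS in
lemma norm_gradStep_sub_gradStep_le (hη : 0 ≤ η) (hηL : η * (κ ^ 2 * L) ≤ 2) (w w' : F)
    (p : X × Y) : ‖gradStep V Φ η w p - gradStep V Φ η w' p‖ ≤ ‖w - w'‖ := by
  set a := ⟪w, Φ p.1⟫_ℝ with ha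
  set b := ⟪w', Φ p.1⟫_ℝ with hb
  set D := leftDeriv (V p.2) a - leftDeriv (V p.2) b with hD
  have hab : ⟪w - w', Φ p.1⟫_ℝ = a - b := inner_sub_left _ _ _
  have hmono : 0 ≤ D * (a - b) := by
    have h1 := sub_le_leftDeriv_mul_sub hB hS p.2 a b
    have h2 := sub_le_leftDeriv_mul_sub hB hS p.2 b a
    rw [hD]; linarith
  have hlip : |D| ≤ L * |a - b| := by
    rw [hD, leftDeriv_eq_deriv (hS.differentiable _ p.2.2 a),
      leftDeriv_eq_deriv (hS.differentiable _ p.2.2 b)]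
    exact hS.lipschitz _ p.2.2 b a
  have hsq : D ^ 2 ≤ L * (D * (a - b)) := by
    rw [← abs_of_nonneg hmono, abs_mul, ← sq_abs, sq, mul_left_comm]
    exact mul_le_mul_of_nonneg_left hlip (abs_nonneg _)
  have hstep : gradStep V Φ η w p - gradStep V Φ η w' p = (w - w') - (η * D) • Φ p.1 := by
    rw [gradStep, gradStep, hD, mul_sub, sub_smul]
    abel
  refine le_of_sq_le_sq ?_ (norm_nonneg _)
  rw [hstep, norm_sub_sq_real, real_inner_smul_right, hab, norm_smul, Real.norm_eq_abs, mul_pow,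
    sq_abs]
  have hφ : ‖Φ p.1‖ ^ 2 ≤ κ ^ 2 := pow_le_pow_left₀ (norm_nonneg _) (hB.norm_le _) 2
  have h3 : (η * D) ^ 2 * ‖Φ p.1‖ ^ 2 ≤ η ^ 2 * (L * (D * (a - b))) * κ ^ 2 := by
    rw [mul_pow]
    exact mul_le_mul (mul_le_mul_of_nonneg_left hsq (sq_nonneg _)) hφ (sq_nonneg _)
      (mul_nonneg (sq_nonneg _) (mul_nonneg hS.L_pos.le hmono))
  have h4 : η * (D * (a - b)) * (η * (κ ^ 2 * L)) ≤ η * (D * (a - b)) * 2 :=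
    mul_le_mul_of_nonneg_left hηL (mul_nonneg hη hmono)
  nlinarith [h3, h4]

-- Expand the square: convexity turns the inner product with the gradient into a difference of
-- losses.
include hB hS in
lemma sq_norm_gradStep_sub_le (hη : 0 ≤ η) (w u : F) (p : X × Y) :
    ‖gradStep V Φ η w p - u‖ ^ 2 ≤
      ‖w - u‖ ^ 2 - 2 * η * (loss V Φ w p - loss V Φ u p) + (η * (a₀ * κ)) ^ 2 := by
  have hstep : gradStep V Φ η w p - u =
      (w - u) - (η * leftDeriv (V p.2) ⟪w, Φ p.1⟫_ℝ) • Φ p.1 := by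
    rw [gradStep]; abel
  have h1 := sub_le_leftDeriv_mul_sub hB hS p.2 ⟪w, Φ p.1⟫_ℝ ⟪u, Φ p.1⟫_ℝ
  have h2 := pow_le_pow_left₀ (norm_nonneg _) (norm_smul_feature_le hB hη w p) 2
  have h3 := mul_le_mul_of_nonneg_left h1 hη
  rw [hstep, norm_sub_sq_real, real_inner_smul_right, inner_sub_left, loss, loss]
  nlinarith

end Steps

section Iterates

lemma iterate_one (η : ℕ → ℝ) (z : Fin m → X × Y) (j : ℕ → Fin m) :
    iterate V Φ η z j 1 = 0 := rfl

lemma iterate_succ (z : Fin m → X × Y) (j : ℕ → Fin m) {k : ℕ} (hk : 1 ≤ k) :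
    iterate V Φ (fun _ => η) z j (k + 1) =
      gradStep V Φ η (iterate V Φ (fun _ => η) z j k) (z (j k)) := by
  obtain ⟨k, rfl⟩ := Nat.exists_eq_add_of_le' hk
  rfl

/-- The `k`-th iterate reads only indices before `k`; this is what makes it independent of `j k`. -/
lemma iterate_update_index (z : Fin m → X × Y) (j : ℕ → Fin m) (i : Fin m) {k n : ℕ}
    (hkn : k ≤ n) :
    iterate V Φ (fun _ => η) z (Function.update j n i) k =
      iterate V Φ (fun _ => η) z j k := by
  induction k with
  | zero => rfl
  | succ k ih =>
    rcases Nat.eq_zero_or_pos k with rfl | hk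
    · rfl
    · rw [iterate_succ z _ hk, iterate_succ z _ hk, ih (by omega),
        Function.update_of_ne (by omega)]

lemma norm_iterate_le (hB : BoundedAssumption Y V Φ κ a₀) (hη : 0 ≤ η) (z : Fin m → X × Y)
    (j : ℕ → Fin m) (k : ℕ) :
    ‖iterate V Φ (fun _ => η) z j k‖ ≤ k * (η * (a₀ * κ)) := by
  have hp := z (j 0)
  have h0 : 0 ≤ η * (a₀ * κ) :=
    mul_nonneg hη (mul_nonneg (hB.slope_nonneg hp.2) (hB.kappa_nonneg hp.1))
  induction k with
  | zero => simp [iterate]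
  | succ k ih =>
    rcases Nat.eq_zero_or_pos k with rfl | hk
    · simpa [iterate_one] using h0
    · rw [iterate_succ z _ hk]
      have h1 := norm_gradStep_sub_le hB hη (iterate V Φ (fun _ => η) z j k) (z (j k))
      have h2 := norm_le_norm_add_norm_sub' (gradStep V Φ η (iterate V Φ (fun _ => η) z j k)
        (z (j k))) (iterate V Φ (fun _ => η) z j k)
      push_cast
      linarith

/-- Stability: a step on a shared example is nonexpansive, while a step on the replaced example
moves each trajectory by at most `η * (a₀ * κ)`. The sum counts the steps of the second kind. -/
lemma norm_iterate_sub_iterate_update_le (hB : BoundedAssumption Y V Φ κ a₀)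
    (hS : SmoothAssumption Y V L) (hη : 0 ≤ η) (hηL : η * (κ ^ 2 * L) ≤ 2)
    (z : Fin m → X × Y) (i : Fin m) (p : X × Y) (j : ℕ → Fin m) (k : ℕ) :
    ‖iterate V Φ (fun _ => η) z j (k + 1) -
        iterate V Φ (fun _ => η) (Function.update z i p) j (k + 1)‖ ≤
      2 * (η * (a₀ * κ)) * ∑ s ∈ Finset.range k, if i = j (s + 1) then (1 : ℝ) else 0 := by
  induction k with
  | zero => simp [iterate_one]
  | succ k ih =>
    rw [iterate_succ z j (by omega : 1 ≤ k + 1), iterate_succ _ j (by omega : 1 ≤ k + 1),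
      Finset.sum_range_succ, mul_add]
    set w := iterate V Φ (fun _ => η) z j (k + 1)
    set w' := iterate V Φ (fun _ => η) (Function.update z i p) j (k + 1)
    by_cases h : i = j (k + 1)
    · rw [if_pos h, mul_one]
      have h1 := norm_gradStep_sub_le hB hη w (z (j (k + 1)))
      have h2 := norm_gradStep_sub_le hB hη w' (Function.update z i p (j (k + 1)))
      have h3 : gradStep V Φ η w (z (j (k + 1))) -
          gradStep V Φ η w' (Function.update z i p (j (k + 1))) =
          (w - w') + (gradStep V Φ η w (z (j (k + 1))) - w) -
          (gradStep V Φ η w' (Function.update z i p (j (k + 1))) - w') := by abel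
      rw [h3]
      refine (norm_sub_le _ _).trans ?_
      have := norm_add_le (w - w') (gradStep V Φ η w (z (j (k + 1))) - w)
      linarith
    · rw [if_neg h, mul_zero, add_zero, Function.update_of_ne (Ne.symm h)]
      exact (norm_gradStep_sub_gradStep_le hB hS hη hηL _ _ _).trans ih

lemma avgIterate_eq (hη : η ≠ 0) (z : Fin m → X × Y) (j : ℕ → Fin m) (t : ℕ) :
    avgIterate V Φ (fun _ => η) z j t =
      ∑ k ∈ Finset.Icc 1 t, (t : ℝ)⁻¹ • iterate V Φ (fun _ => η) z j k := by
  rw [avgIterate, Finset.sum_const, Nat.card_Icc, Nat.add_sub_cancel, nsmul_eq_mul,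
    ← Finset.smul_sum, ← Finset.smul_sum, smul_smul, mul_inv, mul_assoc, inv_mul_cancel₀ hη,
    mul_one]

end Iterates

end Deterministic

/-! ### Measurability of losses and iterates -/

section Measurability

variable {X F : Type*} [MeasurableSpace X] [NormedAddCommGroup F] [InnerProductSpace ℝ F]
variable [SecondCountableTopology F] [MeasurableSpace F] [BorelSpace F]
variable {Y : Set ℝ} {V : ℝ → ℝ → ℝ} {Φ : X → F} {κ a₀ L η : ℝ} {m : ℕ}
variable {Ω : Type*} [MeasurableSpace Ω]

lemma measurable_loss (hV : Measurable (Function.uncurry V)) (hΦ : Measurable Φ)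
    {w : Ω → F} (hw : Measurable w) {p : Ω → X × Y} (hp : Measurable p) :
    Measurable fun ω => loss V Φ (w ω) (p ω) :=
  hV.comp ((measurable_subtype_coe.comp hp.snd).prodMk (hw.inner (hΦ.comp hp.fst)))

/-- By differentiability the left derivative is the pointwise limit of forward difference quotients
with increment `1 / (n + 1)`, jointly measurable in both variables. -/
lemma measurable_leftDeriv (hV : Measurable (Function.uncurry V)) (hS : SmoothAssumption Y V L) :
    Measurable fun q : Y × ℝ => leftDeriv (V q.1) q.2 := by
  have hcoe : Measurable fun q : Y × ℝ => (q.1 : ℝ) := measurable_subtype_coe.comp measurable_fst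
  refine measurable_of_tendsto_metrizable
    (f := fun (n : ℕ) (q : Y × ℝ) =>
      ((n : ℝ) + 1) * (V q.1 (q.2 + 1 / ((n : ℝ) + 1)) - V q.1 q.2)) (fun n => ?_) ?_
  · exact measurable_const.mul ((hV.comp (hcoe.prodMk (measurable_snd.add_const _))).sub
      (hV.comp (hcoe.prodMk measurable_snd)))
  · rw [tendsto_pi_nhds]
    intro q
    rw [leftDeriv_eq_deriv (hS.differentiable q.1 q.1.2 q.2)]
    have h1 := (hS.differentiable q.1 q.1.2 q.2).hasDerivAt.tendsto_slope_zero
    have h2 : Filter.Tendsto (fun n : ℕ => 1 / ((n : ℝ) + 1)) Filter.atTop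
        (nhdsWithin 0 {0}ᶜ) :=
      tendsto_nhdsWithin_iff.2 ⟨tendsto_one_div_add_atTop_nhds_zero_nat,
        Filter.Eventually.of_forall fun n => (Nat.one_div_pos_of_nat).ne'⟩
    refine (h1.comp h2).congr fun n => ?_
    simp

lemma measurable_gradStep (hV : Measurable (Function.uncurry V)) (hΦ : Measurable Φ)
    (hS : SmoothAssumption Y V L) {w : Ω → F} (hw : Measurable w) {p : Ω → X × Y}
    (hp : Measurable p) : Measurable fun ω => gradStep V Φ η (w ω) (p ω) :=
  hw.sub ((((measurable_leftDeriv hV hS).comp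
    (hp.snd.prodMk (hw.inner (hΦ.comp hp.fst)))).const_mul η).smul (hΦ.comp hp.fst))

lemma measurable_eval_index {A : Type*} [MeasurableSpace A] (k : ℕ) :
    Measurable fun q : (Fin m → A) × (ℕ → Fin m) => q.1 (q.2 k) := by
  have h : Measurable fun r : (Fin m → A) × Fin m => r.1 r.2 :=
    measurable_from_prod_countable_left fun i => measurable_pi_apply i
  exact h.comp (measurable_fst.prodMk ((measurable_pi_apply k).comp measurable_snd))

lemma measurable_iterate (hV : Measurable (Function.uncurry V)) (hΦ : Measurable Φ)
    (hS : SmoothAssumption Y V L) (k : ℕ) :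
    Measurable fun q : (Fin m → X × Y) × (ℕ → Fin m) =>
      iterate V Φ (fun _ => η) q.1 q.2 k := by
  induction k with
  | zero => exact measurable_const
  | succ k ih =>
    rcases Nat.eq_zero_or_pos k with rfl | hk
    · exact measurable_const
    · simp only [iterate_succ _ _ hk]
      exact measurable_gradStep hV hΦ hS ih (measurable_eval_index k)

end Measurability

/-! ### Redrawing one coordinate of a product measure -/

section Resampling

open Measure

/-- An independent redraw of one coordinate preserves the product law, as is checked on finite
boxes. It replaces conditional expectations throughout: applied to the indices it averages over
examples, applied to the sample it introduces a fresh example. -/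
lemma measurePreserving_update_infinitePi {ι A : Type*} [DecidableEq ι] [MeasurableSpace A]
    (ν : Measure A) [IsProbabilityMeasure ν] (k : ι) :
    MeasurePreserving (fun r : (ι → A) × A => Function.update r.1 k r.2)
      ((infinitePi fun _ : ι => ν).prod ν) (infinitePi fun _ : ι => ν) := by
  have hm : Measurable fun r : (ι → A) × A => Function.update r.1 k r.2 := by
    refine measurable_pi_lambda _ fun i => ?_
    by_cases h : i = k
    · subst h; simpa using measurable_snd
    · simpa [Function.update_of_ne h] using (measurable_pi_apply i).fun_comp measurable_fst
  refine ⟨hm, eq_infinitePi _ fun s t ht => ?_⟩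
  rw [Measure.map_apply hm (MeasurableSet.pi s.countable_toSet fun i _ => ht i)]
  have hpre : (fun r : (ι → A) × A => Function.update r.1 k r.2) ⁻¹' Set.pi s t =
      Set.pi (s.erase k) t ×ˢ (if k ∈ s then t k else Set.univ) := by
    ext ⟨j, a⟩
    simp only [Set.mem_preimage, Set.mem_pi, Set.mem_prod, Finset.mem_coe, Finset.mem_erase]
    constructor
    · refine fun h => ⟨fun i hi => ?_, ?_⟩
      · simpa [Function.update_of_ne hi.1] using h i hi.2
      · split_ifs with hk
        · simpa using h k hk
        · trivial
    · rintro ⟨h1, h2⟩ i hi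
      by_cases h : i = k
      · subst h; simpa [hi] using h2
      · simpa [Function.update_of_ne h] using h1 i ⟨h, hi⟩
  rw [hpre, Measure.prod_prod, infinitePi_pi _ fun i _ => ht i]
  split_ifs with hk
  · rw [mul_comm, Finset.mul_prod_erase s (fun i => ν (t i)) hk]
  · rw [measure_univ, mul_one, Finset.erase_eq_of_notMem hk]

lemma integral_comp_of_measurePreserving {A B : Type*} [MeasurableSpace A] [MeasurableSpace B]
    {μ : Measure A} {ν : Measure B} {f : A → B} (hf : MeasurePreserving f μ ν) {h : B → ℝ}
    (hh : Integrable h ν) : ∫ b, h b ∂ν = ∫ a, h (f a) ∂μ := by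
  rw [← integral_map hf.measurable.aemeasurable (by rw [hf.map_eq]; exact hh.aestronglyMeasurable),
    hf.map_eq]

variable {X : Type*} [MeasurableSpace X] {Y : Set ℝ} {m : ℕ} [NeZero m]
variable (ρ : Measure (X × Y)) [IsProbabilityMeasure ρ]

instance : IsProbabilityMeasure (law ρ m) := by
  unfold law; infer_instance

lemma integral_uniformOfFintype (h : Fin m → ℝ) :
    ∫ i, h i ∂(PMF.uniformOfFintype (Fin m)).toMeasure = (m : ℝ)⁻¹ * ∑ i, h i := by
  rw [PMF.integral_eq_sum, Finset.mul_sum]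
  simp

lemma integral_update_index (k : ℕ) {h : (Fin m → X × Y) × (ℕ → Fin m) → ℝ}
    (hh : Integrable h (law ρ m)) :
    ∫ q, h q ∂(law ρ m) =
      ∫ q, (m : ℝ)⁻¹ * ∑ i, h (q.1, Function.update q.2 k i) ∂(law ρ m) := by
  set ν := (PMF.uniformOfFintype (Fin m)).toMeasure
  have h1 : MeasurePreserving
      (fun r : ((Fin m → X × Y) × (ℕ → Fin m)) × Fin m => (r.1.1, Function.update r.1.2 k r.2))
      ((law ρ m).prod ν) (law ρ m) :=
    ((MeasurePreserving.id _).prod (measurePreserving_update_infinitePi ν k)).comp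
      (measurePreserving_prodAssoc _ _ _)
  have h2 := h1.integrable_comp_of_integrable hh
  rw [integral_comp_of_measurePreserving h1 hh]
  refine (integral_prod _ h2).trans ?_
  exact integral_congr_ae (Filter.Eventually.of_forall fun q => integral_uniformOfFintype _)

lemma integral_update_sample (i : Fin m) {h : (Fin m → X × Y) × (ℕ → Fin m) → ℝ}
    (hh : Integrable h (law ρ m)) :
    ∫ q, h q ∂(law ρ m) =
      ∫ q, ∫ p, h (Function.update q.1 i p, q.2) ∂ρ ∂(law ρ m) := by
  have h0 := measurePreserving_update_infinitePi ρ i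
  rw [infinitePi_eq_pi] at h0
  have h1 : MeasurePreserving
      (fun r : ((Fin m → X × Y) × (ℕ → Fin m)) × (X × Y) => (Function.update r.1.1 i r.2, r.1.2))
      ((law ρ m).prod ρ) (law ρ m) :=
    (h0.prod (MeasurePreserving.id _)).comp <|
      ((measurePreserving_prodAssoc _ _ _).symm MeasurableEquiv.prodAssoc).comp <|
      ((MeasurePreserving.id _).prod measurePreserving_swap).comp
      (measurePreserving_prodAssoc _ _ _)
  have h2 := h1.integrable_comp_of_integrable hh
  rw [integral_comp_of_measurePreserving h1 hh]
  refine (integral_prod _ h2).trans ?_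
  rfl

end Resampling

/-! ### Integrability from bounded parameters -/

section Integrability

variable {X F : Type*} [MeasurableSpace X] [NormedAddCommGroup F] [InnerProductSpace ℝ F]
variable [SecondCountableTopology F] [MeasurableSpace F] [BorelSpace F]
variable {Y : Set ℝ} {V : ℝ → ℝ → ℝ} {Φ : X → F} {κ a₀ L η B : ℝ} {m : ℕ}
variable {Ω : Type*} [MeasurableSpace Ω]

lemma loss_nonneg (hV0 : ∀ y a, 0 ≤ V y a) (w : F) (p : X × Y) : 0 ≤ loss V Φ w p := hV0 _ _

lemma exists_loss_le (hB : BoundedAssumption Y V Φ κ a₀) (hS : SmoothAssumption Y V L) (B : ℝ) :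
    ∃ M, ∀ (w : F) (p : X × Y), ‖w‖ ≤ B → loss V Φ w p ≤ M := by
  obtain ⟨M, hM⟩ := hB.bddAbove_zero
  refine ⟨M + a₀ * κ * B, fun w p hw => ?_⟩
  have h1 := (abs_le.1 (abs_loss_sub_le hB hS w 0 p)).2
  have h2 : loss V Φ (0 : F) p ≤ M := by
    rw [loss, inner_zero_left]; exact hM ⟨p.2, p.2.2, rfl⟩
  rw [sub_zero] at h1
  have := mul_le_mul_of_nonneg_left hw
    (mul_nonneg (hB.slope_nonneg p.2) (hB.kappa_nonneg p.1))
  linarith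

lemma integrable_loss (hV : Measurable (Function.uncurry V)) (hV0 : ∀ y a, 0 ≤ V y a)
    (hΦ : Measurable Φ) (hB : BoundedAssumption Y V Φ κ a₀) (hS : SmoothAssumption Y V L)
    (μ : Measure Ω) [IsFiniteMeasure μ] {w : Ω → F} (hw : Measurable w) (hwB : ∀ ω, ‖w ω‖ ≤ B)
    {p : Ω → X × Y} (hp : Measurable p) :
    Integrable (fun ω => loss V Φ (w ω) (p ω)) μ := by
  obtain ⟨M, hM⟩ := exists_loss_le (F := F) hB hS B
  refine Integrable.of_bound (measurable_loss hV hΦ hw hp).aestronglyMeasurable M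
    (Filter.Eventually.of_forall fun ω => ?_)
  rw [Real.norm_eq_abs, abs_of_nonneg (loss_nonneg hV0 _ _)]
  exact hM _ _ (hwB ω)

lemma integrable_risk (hV : Measurable (Function.uncurry V)) (hV0 : ∀ y a, 0 ≤ V y a)
    (hΦ : Measurable Φ) (hB : BoundedAssumption Y V Φ κ a₀) (hS : SmoothAssumption Y V L)
    (μ : Measure Ω) [IsFiniteMeasure μ] (ρ : Measure (X × Y)) [IsProbabilityMeasure ρ]
    {w : Ω → F} (hw : Measurable w) (hwB : ∀ ω, ‖w ω‖ ≤ B) :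
    Integrable (fun ω => risk ρ V Φ (w ω)) μ :=
  (integrable_loss hV hV0 hΦ hB hS (μ.prod ρ) (hw.comp measurable_fst) (fun r => hwB r.1)
    measurable_snd).integral_prod_left

lemma integrable_sq_norm_sub (μ : Measure Ω) [IsFiniteMeasure μ] {w u : Ω → F}
    (hw : Measurable w) {B : ℝ} (hwB : ∀ ω, ‖w ω‖ ≤ B) (hu : Measurable u) {B' : ℝ}
    (huB : ∀ ω, ‖u ω‖ ≤ B') : Integrable (fun ω => ‖w ω - u ω‖ ^ 2) μ := by
  refine Integrable.of_bound ((hw.sub hu).norm.pow_const 2).aestronglyMeasurable ((B + B') ^ 2)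
    (Filter.Eventually.of_forall fun ω => ?_)
  rw [Real.norm_eq_abs, abs_of_nonneg (sq_nonneg _)]
  exact pow_le_pow_left₀ (norm_nonneg _)
    ((norm_sub_le _ _).trans (add_le_add (hwB ω) (huB ω))) 2

end Integrability

/-! ### Optimization and generalization bounds in expectation -/

section Expectation

variable {X F : Type*} [MeasurableSpace X] [NormedAddCommGroup F] [InnerProductSpace ℝ F]
variable [SecondCountableTopology F] [MeasurableSpace F] [BorelSpace F]
variable {Y : Set ℝ} {V : ℝ → ℝ → ℝ} {Φ : X → F} {κ a₀ L η B : ℝ} {m : ℕ} [NeZero m]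
variable {ρ : Measure (X × Y)} [IsProbabilityMeasure ρ]

/-- The expected risk of the `k`-th iterate. -/
def expRisk (ρ : Measure (X × Y)) (V : ℝ → ℝ → ℝ) (Φ : X → F) (η : ℝ) (m : ℕ) [NeZero m]
    (k : ℕ) : ℝ :=
  ∫ q, risk ρ V Φ (iterate V Φ (fun _ => η) q.1 q.2 k) ∂(law ρ m)

/-- The expected empirical risk of the `k`-th iterate. -/
def expEmpRisk (ρ : Measure (X × Y)) (V : ℝ → ℝ → ℝ) (Φ : X → F) (η : ℝ) (m : ℕ) [NeZero m]
    (k : ℕ) : ℝ :=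
  ∫ q, empRisk V Φ q.1 (iterate V Φ (fun _ => η) q.1 q.2 k) ∂(law ρ m)

variable (hV : Measurable (Function.uncurry V)) (hV0 : ∀ y a, 0 ≤ V y a) (hΦ : Measurable Φ)
  (hB : BoundedAssumption Y V Φ κ a₀) (hS : SmoothAssumption Y V L)
include hV hV0 hΦ hB hS

lemma integral_loss_index {k : ℕ} {w : (Fin m → X × Y) × (ℕ → Fin m) → F} (hw : Measurable w)
    (hwB : ∀ q, ‖w q‖ ≤ B) (hinv : ∀ z j i, w (z, Function.update j k i) = w (z, j)) :
    ∫ q, loss V Φ (w q) (q.1 (q.2 k)) ∂(law ρ m) = ∫ q, empRisk V Φ q.1 (w q) ∂(law ρ m) := by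
  rw [integral_update_index ρ k
    (integrable_loss hV hV0 hΦ hB hS (law ρ m) hw hwB (measurable_eval_index k))]
  simp only [hinv, Function.update_self, empRisk]

lemma integral_sq_norm_succ_sub_le (hη : 0 ≤ η) {k : ℕ} (hk : 1 ≤ k)
    {u : (Fin m → X × Y) × (ℕ → Fin m) → F} (hu : Measurable u) (huB : ∀ q, ‖u q‖ ≤ B)
    (hinv : ∀ z j i, u (z, Function.update j k i) = u (z, j)) :
    ∫ q, ‖iterate V Φ (fun _ => η) q.1 q.2 (k + 1) - u q‖ ^ 2 ∂(law ρ m) ≤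
      ∫ q, ‖iterate V Φ (fun _ => η) q.1 q.2 k - u q‖ ^ 2 ∂(law ρ m) -
        2 * η * (expEmpRisk ρ V Φ η m k - ∫ q, empRisk V Φ q.1 (u q) ∂(law ρ m)) +
        (η * (a₀ * κ)) ^ 2 := by
  have hW : ∀ k, Measurable fun q : (Fin m → X × Y) × (ℕ → Fin m) =>
      iterate V Φ (fun _ => η) q.1 q.2 k := measurable_iterate hV hΦ hS
  have hWB : ∀ k, ∀ q : (Fin m → X × Y) × (ℕ → Fin m), _ ≤ _ := fun k q =>
    norm_iterate_le hB hη q.1 q.2 k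
  have i1 := fun k => integrable_sq_norm_sub (law ρ m) (hW k) (hWB k) hu huB
  have i2 := integrable_loss hV hV0 hΦ hB hS (law ρ m) (hW k) (hWB k) (measurable_eval_index k)
  have i3 := integrable_loss hV hV0 hΦ hB hS (law ρ m) hu huB (measurable_eval_index k)
  have e2 := integral_loss_index (ρ := ρ) hV hV0 hΦ hB hS (hW k) (hWB k)
    (fun z j i => iterate_update_index z j i le_rfl)
  have e3 := integral_loss_index (ρ := ρ) hV hV0 hΦ hB hS hu huB hinv
  have i4 : Integrable (fun q : (Fin m → X × Y) × (ℕ → Fin m) =>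
      2 * η * (loss V Φ (iterate V Φ (fun _ => η) q.1 q.2 k) (q.1 (q.2 k)) -
        loss V Φ (u q) (q.1 (q.2 k)))) (law ρ m) := (i2.sub i3).const_mul _
  refine (integral_mono (i1 (k + 1)) (((i1 k).sub i4).add
    (integrable_const ((η * (a₀ * κ)) ^ 2))) fun q => ?_).trans_eq ?_
  · simp only [iterate_succ _ _ hk]
    exact sq_norm_gradStep_sub_le hB hS hη _ _ _
  · refine (integral_add ((i1 k).sub i4) (integrable_const _)).trans ?_
    rw [integral_sub' (i1 k) i4,
      integral_const_mul, integral_sub i2 i3, e2, e3]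
    simp [expEmpRisk]

/-- Telescope the one-step inequality and drop the final squared distance. The comparison point may
be random, provided it ignores the indices from `s` on; this admits both a fixed `w` and the iterate
`w_s` itself, for which the distance term vanishes. -/
lemma sum_expEmpRisk_sub_le (hη : 0 < η) {s : ℕ} (hs : 1 ≤ s) (n : ℕ)
    {u : (Fin m → X × Y) × (ℕ → Fin m) → F} (hu : Measurable u) (huB : ∀ q, ‖u q‖ ≤ B)
    (hinv : ∀ k, s ≤ k → ∀ z j i, u (z, Function.update j k i) = u (z, j)) :
    ∑ k ∈ Finset.range n, (expEmpRisk ρ V Φ η m (s + k) -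
        ∫ q, empRisk V Φ q.1 (u q) ∂(law ρ m)) ≤
      (∫ q, ‖iterate V Φ (fun _ => η) q.1 q.2 s - u q‖ ^ 2 ∂(law ρ m)) / (2 * η) +
        n * (η * (a₀ * κ) ^ 2 / 2) := by
  have key : 2 * η * ∑ k ∈ Finset.range n, (expEmpRisk ρ V Φ η m (s + k) -
        ∫ q, empRisk V Φ q.1 (u q) ∂(law ρ m)) ≤
      ∫ q, ‖iterate V Φ (fun _ => η) q.1 q.2 s - u q‖ ^ 2 ∂(law ρ m) -
        ∫ q, ‖iterate V Φ (fun _ => η) q.1 q.2 (s + n) - u q‖ ^ 2 ∂(law ρ m) +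
        n * (η * (a₀ * κ)) ^ 2 := by
    induction n with
    | zero => simp
    | succ n ih =>
      have := integral_sq_norm_succ_sub_le (ρ := ρ) hV hV0 hΦ hB hS hη.le
        (by omega : 1 ≤ s + n) hu huB (hinv (s + n) (by omega))
      rw [Finset.sum_range_succ, mul_add]
      push_cast
      rw [← add_assoc s n 1]
      linarith
  have hpos : 0 ≤ ∫ q, ‖iterate V Φ (fun _ => η) q.1 q.2 (s + n) - u q‖ ^ 2 ∂(law ρ m) :=
    integral_nonneg fun q => sq_nonneg _
  refine le_of_mul_le_mul_left ?_ (by positivity : 0 < 2 * η)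
  rw [mul_add, mul_div_cancel₀ _ (by positivity)]
  nlinarith

lemma sum_expEmpRisk_sub_self_le (hη : 0 < η) {s : ℕ} (hs : 1 ≤ s) (n : ℕ) :
    ∑ k ∈ Finset.range n, (expEmpRisk ρ V Φ η m (s + k) - expEmpRisk ρ V Φ η m s) ≤
      n * (η * (a₀ * κ) ^ 2 / 2) := by
  have := sum_expEmpRisk_sub_le (ρ := ρ) (m := m) hV hV0 hΦ hB hS hη hs n
    (measurable_iterate hV hΦ hS s) (fun q => norm_iterate_le hB hη.le q.1 q.2 s)
    (fun k hk z j i => iterate_update_index z j i hk)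
  simpa [expEmpRisk] using this

lemma integral_empRisk_const (w : F) :
    ∫ q, empRisk V Φ q.1 w ∂(law ρ m) = risk ρ V Φ w := by
  have h1 : ∀ i : Fin m, ∫ q : (Fin m → X × Y) × (ℕ → Fin m), loss V Φ w (q.1 i) ∂(law ρ m) =
      risk ρ V Φ w := fun i => by
    have hp : MeasurePreserving (fun q : (Fin m → X × Y) × (ℕ → Fin m) => q.1 i) (law ρ m) ρ :=
      (measurePreserving_eval (fun _ : Fin m => ρ) i).comp measurePreserving_fst
    exact (integral_comp_of_measurePreserving hp (integrable_loss hV hV0 hΦ hB hS ρ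
      (measurable_const (a := w)) (fun _ => le_rfl) measurable_id)).symm
  have hm : (m : ℝ) ≠ 0 := NeZero.ne _
  simp only [empRisk]
  rw [integral_const_mul, integral_finsetSum _ fun i _ => integrable_loss hV hV0 hΦ hB hS _
    (measurable_const (a := w)) (fun _ => le_rfl) ((measurable_pi_apply i).fun_comp measurable_fst)]
  simp [h1, hm]

lemma sum_expEmpRisk_le (hη : 0 < η) (n : ℕ) (w : F) :
    ∑ k ∈ Finset.range n, expEmpRisk ρ V Φ η m (1 + k) ≤
      n * risk ρ V Φ w + ‖w‖ ^ 2 / (2 * η) + n * (η * (a₀ * κ) ^ 2 / 2) := by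
  have := sum_expEmpRisk_sub_le (ρ := ρ) (m := m) hV hV0 hΦ hB hS hη le_rfl n
    (measurable_const (a := w)) (fun q => le_rfl) (fun k hk z j i => rfl)
  rw [integral_empRisk_const hV hV0 hΦ hB hS] at this
  simp only [iterate_one, zero_sub, norm_neg, integral_const, probReal_univ, one_smul,
    Finset.sum_sub_distrib, Finset.sum_const, Finset.card_range, nsmul_eq_mul] at this
  linarith

lemma expRisk_le_expEmpRisk_add (hη : 0 ≤ η) (hηL : η * (κ ^ 2 * L) ≤ 2) (k : ℕ) :
    expRisk ρ V Φ η m (k + 1) ≤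
      expEmpRisk ρ V Φ η m (k + 1) + 2 * η * (a₀ * κ) ^ 2 * k / m := by
  set G := a₀ * κ with hG
  obtain ⟨x₀, y₀⟩ : Nonempty (X × Y) := ρ.nonempty_of_neZero
  have hG0 : 0 ≤ G := mul_nonneg (hB.slope_nonneg y₀) (hB.kappa_nonneg x₀)
  have hm : (0 : ℝ) < m := Nat.cast_pos.2 (NeZero.pos m)
  set W : (Fin m → X × Y) × (ℕ → Fin m) → F := fun q =>
    iterate V Φ (fun _ => η) q.1 q.2 (k + 1) with hWdef
  have hW : Measurable W := measurable_iterate hV hΦ hS _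
  have hWB : ∀ q, ‖W q‖ ≤ _ := fun q => norm_iterate_le hB hη q.1 q.2 (k + 1)
  set N : Fin m → (ℕ → Fin m) → ℝ := fun i j =>
    ∑ s ∈ Finset.range k, if i = j (s + 1) then (1 : ℝ) else 0 with hN
  have iR := integrable_risk hV hV0 hΦ hB hS (law ρ m) ρ hW hWB
  have iL : ∀ i : Fin m, Integrable (fun q => loss V Φ (W q) (q.1 i)) (law ρ m) := fun i =>
    integrable_loss hV hV0 hΦ hB hS _ hW hWB ((measurable_pi_apply i).comp measurable_fst)
  have iN : ∀ i, Integrable (fun q : (Fin m → X × Y) × (ℕ → Fin m) => N i q.2) (law ρ m) := by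
    intro i
    refine integrable_finsetSum _ fun s _ => ?_
    refine Integrable.of_bound (C := 1) (Measurable.aestronglyMeasurable ?_)
      (Filter.Eventually.of_forall fun q => ?_)
    · exact (measurable_of_countable fun r : Fin m => if i = r then (1 : ℝ) else 0).comp
        ((measurable_pi_apply (s + 1)).comp measurable_snd)
    · split_ifs <;> simp
  have key : ∀ i : Fin m, expRisk ρ V Φ η m (k + 1) -
      ∫ q, loss V Φ (W q) (q.1 i) ∂(law ρ m) ≤ ∫ q, 2 * η * G ^ 2 * N i q.2 ∂(law ρ m) := by
    intro i
    have hup : Measurable fun r : ((Fin m → X × Y) × (ℕ → Fin m)) × (X × Y) =>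
        (Function.update r.1.1 i r.2, r.1.2) := by
      refine Measurable.prodMk (measurable_pi_lambda _ fun l => ?_) (by fun_prop)
      by_cases h : l = i
      · subst h; simpa using measurable_snd
      · simpa [Function.update_of_ne h] using
          (measurable_pi_apply l).fun_comp (measurable_fst.comp measurable_fst)
    have iU : Integrable (fun q => ∫ p, loss V Φ (W (Function.update q.1 i p, q.2)) p ∂ρ)
        (law ρ m) :=
      (integrable_loss hV hV0 hΦ hB hS ((law ρ m).prod ρ) (hW.comp hup) (fun r => hWB _)
        measurable_snd).integral_prod_left
    -- After the exchange the perturbed iterate is tested on the fresh `p`, as is `W q` in the risk,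
    -- so only the stability of the iterates matters.
    rw [integral_update_sample ρ i (iL i)]
    simp only [Function.update_self]
    rw [expRisk, ← integral_sub iR iU]
    refine integral_mono (iR.sub iU) ((iN i).const_mul _) fun q => ?_
    have iw := integrable_loss hV hV0 hΦ hB hS ρ (measurable_const (a := W q)) (fun _ => le_rfl)
      measurable_id
    have iw' := integrable_loss hV hV0 hΦ hB hS ρ
      (hW.comp (hup.comp (measurable_const (a := q) |>.prodMk measurable_id))) (fun r => hWB _)
      measurable_id
    change ∫ p, loss V Φ (W q) p ∂ρ - ∫ p, loss V Φ (W (Function.update q.1 i p, q.2)) p ∂ρ ≤ _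
    refine (integral_sub iw iw').symm.le.trans ?_
    have hc : 2 * η * G ^ 2 * N i q.2 = ∫ _, 2 * η * G ^ 2 * N i q.2 ∂ρ := by simp
    rw [hc]
    refine integral_mono (iw.sub iw') (integrable_const _) fun p => ?_
    refine (le_abs_self _).trans ((abs_loss_sub_le hB hS _ _ _).trans ?_)
    have := norm_iterate_sub_iterate_update_le hB hS hη hηL q.1 i p q.2 k
    calc a₀ * κ * _ ≤ G * (2 * (η * G) * N i q.2) := mul_le_mul_of_nonneg_left this hG0
      _ = _ := by ring
  -- Each of the `k` steps leading to iterate `k + 1` draws exactly one example; averaging over `i`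
  -- thus yields the factor `k / m`.
  have hsum : ∀ j : ℕ → Fin m, ∑ i, N i j = k := fun j => by
    simp only [hN]
    rw [Finset.sum_comm]
    simp
  have hE : expEmpRisk ρ V Φ η m (k + 1) =
      (m : ℝ)⁻¹ * ∑ i : Fin m, ∫ q, loss V Φ (W q) (q.1 i) ∂(law ρ m) := by
    rw [← integral_finsetSum _ fun i _ => iL i, ← integral_const_mul]
    rfl
  have htot := Finset.sum_le_sum fun i (_ : i ∈ Finset.univ) => key i
  rw [Finset.sum_sub_distrib, ← integral_finsetSum _ fun i _ => (iN i).const_mul _] at htot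
  simp only [← Finset.mul_sum, hsum, Finset.sum_const, Finset.card_univ, Fintype.card_fin,
    nsmul_eq_mul, integral_const, probReal_univ, one_smul] at htot
  rw [hE, ← sub_le_iff_le_add', le_div_iff₀ hm, sub_mul, mul_right_comm, inv_mul_cancel₀ hm.ne']
  linarith

lemma convexOn_risk : ConvexOn ℝ Set.univ (risk ρ V Φ) := by
  have i1 : ∀ w : F, Integrable (fun p => loss V Φ w p) ρ := fun w =>
    integrable_loss hV hV0 hΦ hB hS ρ (measurable_const (a := w)) (fun _ => le_rfl) measurable_id
  refine ⟨convex_univ, fun w _ w' _ a b ha hb hab => ?_⟩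
  simp only [smul_eq_mul]
  have h : ∫ p, (a * loss V Φ w p + b * loss V Φ w' p) ∂ρ =
      a * risk ρ V Φ w + b * risk ρ V Φ w' := by
    rw [integral_add ((i1 w).const_mul a) ((i1 w').const_mul b), integral_const_mul,
      integral_const_mul]
    rfl
  rw [← h]
  refine integral_mono (i1 _) (((i1 w).const_mul a).add ((i1 w').const_mul b)) fun p => ?_
  have := (hB.convex p.2 p.2.2).2 (Set.mem_univ ⟪w, Φ p.1⟫_ℝ) (Set.mem_univ ⟪w', Φ p.1⟫_ℝ)
    ha hb hab
  simpa only [loss, inner_add_left, real_inner_smul_left, smul_eq_mul] using this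

lemma integral_risk_average_le (hη : 0 ≤ η) {t : ℕ} (ht : 1 ≤ t) {w : (Fin m → X × Y) ×
    (ℕ → Fin m) → F} (hw : Measurable w) (hwB : ∀ q, ‖w q‖ ≤ B)
    (hwe : ∀ q, w q = ∑ k ∈ Finset.Icc 1 t, (t : ℝ)⁻¹ • iterate V Φ (fun _ => η) q.1 q.2 k) :
    ∫ q, risk ρ V Φ (w q) ∂(law ρ m) ≤
      (t : ℝ)⁻¹ * ∑ k ∈ Finset.range t, expRisk ρ V Φ η m (1 + k) := by
  have ht0 : (t : ℝ) ≠ 0 := by positivity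
  have iR : ∀ k, Integrable (fun q => risk ρ V Φ (iterate V Φ (fun _ => η) q.1 q.2 k))
      (law ρ m) := fun k => integrable_risk hV hV0 hΦ hB hS _ ρ (measurable_iterate hV hΦ hS k)
    (fun q => norm_iterate_le hB hη q.1 q.2 k)
  have hI : ∑ k ∈ Finset.range t, expRisk ρ V Φ η m (1 + k) =
      ∑ k ∈ Finset.Icc 1 t, expRisk ρ V Φ η m k := by
    rw [← Finset.Ico_add_one_right_eq_Icc, Finset.sum_Ico_eq_sum_range, Nat.add_sub_cancel]
  rw [hI, Finset.mul_sum]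
  simp only [expRisk, ← integral_const_mul]
  rw [← integral_finsetSum _ fun k _ => (iR k).const_mul _]
  refine integral_mono (integrable_risk hV hV0 hΦ hB hS _ ρ hw hwB)
    (integrable_finsetSum _ fun k _ => (iR k).const_mul _) fun q => ?_
  simp only [hwe]
  refine (convexOn_risk hV hV0 hΦ hB hS).map_sum_le (fun _ _ => by positivity) ?_
    fun _ _ => Set.mem_univ _
  simp [ht0]

end Expectation

/-! ### From averages to the last term -/

/-- If the average of every final block exceeds its first term by at most `c`, the last term
exceeds the average of all the terms by at most `c` times a harmonic sum. -/
lemma last_le_average_add {f : ℕ → ℝ} {c : ℝ}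
    (h : ∀ s n, 1 ≤ s → ∑ k ∈ Finset.range n, (f (s + k) - f s) ≤ n * c) (n : ℕ) :
    f (n + 1) ≤ ((n : ℝ) + 1)⁻¹ * ∑ k ∈ Finset.range (n + 1), f (1 + k) + c * harmonic n := by
  -- Let `A r` be the average of the last `r + 1` terms. Prepending a term `a` gives `A r - A (r +
  -- 1) = (A (r + 1) - a) / (r + 1)`, at most `c / (r + 1)` by hypothesis; these increments sum to
  -- the harmonic number.
  have key : ∀ r ≤ n, f (n + 1) ≤
      ((r : ℝ) + 1)⁻¹ * ∑ k ∈ Finset.range (r + 1), f (n + 1 - r + k) + c * harmonic r := by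
    intro r hr
    induction r with
    | zero => simp
    | succ r ih =>
      refine (ih (by omega)).trans ?_
      have h1 := h (n + 1 - (r + 1)) (r + 2) (by omega)
      rw [Finset.sum_sub_distrib, Finset.sum_const, Finset.card_range, nsmul_eq_mul] at h1
      have h2 := Finset.sum_range_succ' (fun k => f (n + 1 - (r + 1) + k)) (r + 1)
      have h3 : ∑ k ∈ Finset.range (r + 1), f (n + 1 - (r + 1) + (k + 1)) =
          ∑ k ∈ Finset.range (r + 1), f (n + 1 - r + k) :=
        Finset.sum_congr rfl fun k _ => by congr 1; omega
      rw [h3, add_zero] at h2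
      rw [h2] at h1 ⊢
      set S := ∑ k ∈ Finset.range (r + 1), f (n + 1 - r + k)
      set a := f (n + 1 - (r + 1))
      rw [harmonic_succ]
      push_cast at h1 ⊢
      have hr0 : (0 : ℝ) < r + 1 := by positivity
      have hr1 : (0 : ℝ) < r + 1 + 1 := by positivity
      have h4 : S ≤ (r + 1) * a + (r + 2) * c := by linarith
      rw [← sub_nonneg]
      have h5 : ((r : ℝ) + 1 + 1)⁻¹ * (S + a) + c * (harmonic r + ((r : ℝ) + 1)⁻¹) -
          (((r : ℝ) + 1)⁻¹ * S + c * harmonic r) =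
          ((r + 1) * a + (r + 2) * c - S) / ((r + 1) * (r + 1 + 1)) := by
        field_simp
        ring
      rw [h5]
      exact div_nonneg (by linarith) (by positivity)
  have := key n le_rfl
  rwa [Nat.add_sub_cancel_left] at this

/-! ### Assembling the excess risk bounds -/

section ExcessRisk

variable {X F : Type*} [MeasurableSpace X] [NormedAddCommGroup F] [InnerProductSpace ℝ F]
variable [SecondCountableTopology F] [MeasurableSpace F] [BorelSpace F]
variable {Y : Set ℝ} {V : ℝ → ℝ → ℝ} {Φ : X → F} {κ a₀ L η : ℝ} {m : ℕ} [NeZero m]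
variable {ρ : Measure (X × Y)} [IsProbabilityMeasure ρ]

lemma sub_infRisk_le_add_approxError {E b lam : ℝ}
    (h : ∀ w : F, E ≤ b + (risk ρ V Φ w + lam / 2 * ‖w‖ ^ 2)) :
    E - infRisk ρ V Φ ≤ b + approxError ρ V Φ lam := by
  have : E - b ≤ ⨅ w : F, (risk ρ V Φ w + lam / 2 * ‖w‖ ^ 2) :=
    le_ciInf fun w => by linarith [h w]
  rw [approxError]
  linarith

variable (hV : Measurable (Function.uncurry V)) (hV0 : ∀ y a, 0 ≤ V y a) (hΦ : Measurable Φ)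
  (hB : BoundedAssumption Y V Φ κ a₀) (hS : SmoothAssumption Y V L)
include hV hV0 hΦ hB hS

lemma average_expEmpRisk_le (hη : 0 < η) {t : ℕ} (ht : 1 ≤ t) (w : F) :
    (t : ℝ)⁻¹ * ∑ k ∈ Finset.range t, expEmpRisk ρ V Φ η m (1 + k) ≤
      risk ρ V Φ w + 1 / (η * t) / 2 * ‖w‖ ^ 2 + η * (a₀ * κ) ^ 2 / 2 := by
  have ht0 : (0 : ℝ) < t := by positivity
  rw [inv_mul_le_iff₀ ht0]
  refine (sum_expEmpRisk_le hV hV0 hΦ hB hS hη t w).trans_eq ?_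
  field_simp

/-- In `2 + Real.log t`, one unit comes from the averaged optimization bound and the rest from the
harmonic sum of the last-iterate argument. -/
lemma expRisk_sub_infRisk_le (hη : 0 < η) (hηL : η * (κ ^ 2 * L) ≤ 2) {t : ℕ} (ht : 1 ≤ t) :
    expRisk ρ V Φ η m t - infRisk ρ V Φ ≤
      2 * η * (a₀ * κ) ^ 2 * (t / m) + η * (a₀ * κ) ^ 2 / 2 * (2 + Real.log t) +
        approxError ρ V Φ (1 / (η * t)) := by
  refine sub_infRisk_le_add_approxError fun w => ?_
  obtain ⟨n, rfl⟩ := Nat.exists_eq_add_of_le' ht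
  have h1 := expRisk_le_expEmpRisk_add (ρ := ρ) (m := m) hV hV0 hΦ hB hS hη.le hηL n
  have h2 := last_le_average_add (fun s n hs =>
    sum_expEmpRisk_sub_self_le (ρ := ρ) (m := m) hV hV0 hΦ hB hS hη hs n) n
  have h3 := average_expEmpRisk_le (ρ := ρ) (m := m) hV hV0 hΦ hB hS hη ht w
  have h4 : (harmonic n : ℝ) ≤ 1 + Real.log ((n + 1 : ℕ) : ℝ) := by
    refine le_trans ?_ (harmonic_le_one_add_log (n + 1))
    rw [harmonic_succ]
    push_cast
    linarith [show (0 : ℝ) ≤ ((n : ℝ) + 1)⁻¹ by positivity]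
  have h5 := mul_le_mul_of_nonneg_left h4
    (by positivity : 0 ≤ η * (a₀ * κ) ^ 2 / 2)
  have h6 : 2 * η * (a₀ * κ) ^ 2 * n / m ≤ 2 * η * (a₀ * κ) ^ 2 * (((n + 1 : ℕ) : ℝ) / m) := by
    rw [mul_div_assoc]
    gcongr
    omega
  push_cast at h3 h5 h6 ⊢
  linarith

lemma average_expRisk_sub_infRisk_le (hη : 0 < η) (hηL : η * (κ ^ 2 * L) ≤ 2) {t : ℕ}
    (ht : 1 ≤ t) :
    (t : ℝ)⁻¹ * ∑ k ∈ Finset.range t, expRisk ρ V Φ η m (1 + k) - infRisk ρ V Φ ≤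
      2 * η * (a₀ * κ) ^ 2 * (t / m) + η * (a₀ * κ) ^ 2 / 2 * (2 + Real.log t) +
        approxError ρ V Φ (1 / (η * t)) := by
  refine sub_infRisk_le_add_approxError fun w => ?_
  have ht0 : (0 : ℝ) < t := by positivity
  have h1 : ∑ k ∈ Finset.range t, expRisk ρ V Φ η m (1 + k) ≤
      ∑ k ∈ Finset.range t, expEmpRisk ρ V Φ η m (1 + k) +
        t * (2 * η * (a₀ * κ) ^ 2 * (t / m)) := by
    have hconst : (t : ℝ) * (2 * η * (a₀ * κ) ^ 2 * (t / m)) =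
        ∑ _k ∈ Finset.range t, 2 * η * (a₀ * κ) ^ 2 * ((t : ℝ) / m) := by simp
    rw [hconst, ← Finset.sum_add_distrib]
    refine Finset.sum_le_sum fun k hk => ?_
    have h := expRisk_le_expEmpRisk_add (ρ := ρ) (m := m) hV hV0 hΦ hB hS hη.le hηL k
    rw [add_comm 1 k]
    refine h.trans (add_le_add_right ?_ _)
    rw [mul_div_assoc]
    have := (Finset.mem_range.1 hk).le
    gcongr
  have h2 := mul_le_mul_of_nonneg_left h1 (inv_nonneg.2 ht0.le)
  rw [mul_add, inv_mul_cancel_left₀ ht0.ne'] at h2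
  have h3 := average_expEmpRisk_le (ρ := ρ) (m := m) hV hV0 hΦ hB hS hη ht w
  -- The average incurs no logarithm; this slack gives it the same bound as the last iterate.
  have h4 : 0 ≤ η * (a₀ * κ) ^ 2 / 2 * (1 + Real.log t) :=
    mul_nonneg (by positivity) (by linarith [Real.log_natCast_nonneg t])
  linarith

lemma expectedExcessRiskLE_of_le (hη : 0 < η) (hηL : η * (κ ^ 2 * L) ≤ 2) {t : ℕ} (ht : 1 ≤ t)
    {g : (Fin m → X × Y) → (ℕ → Fin m) → ℕ → F}
    (hg : g = avgIterate V Φ (fun _ => η) ∨ g = iterate V Φ (fun _ => η)) {b : ℝ}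
    (hb : 2 * η * (a₀ * κ) ^ 2 * (t / m) + η * (a₀ * κ) ^ 2 / 2 * (2 + Real.log t) +
      approxError ρ V Φ (1 / (η * t)) ≤ b) :
    ExpectedExcessRiskLE ρ V Φ m (fun z j => g z j t) b := by
  have hW : ∀ k, Measurable fun q : (Fin m → X × Y) × (ℕ → Fin m) =>
      iterate V Φ (fun _ => η) q.1 q.2 k := measurable_iterate hV hΦ hS
  have hWB : ∀ k, ∀ q : (Fin m → X × Y) × (ℕ → Fin m), _ ≤ _ := fun k q =>
    norm_iterate_le hB hη.le q.1 q.2 k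
  suffices h : ∃ B, Measurable (fun q : (Fin m → X × Y) × (ℕ → Fin m) => g q.1 q.2 t) ∧
      (∀ q : (Fin m → X × Y) × (ℕ → Fin m), ‖g q.1 q.2 t‖ ≤ B) ∧
      ∫ q, risk ρ V Φ (g q.1 q.2 t) ∂(law ρ m) - infRisk ρ V Φ ≤ b by
    obtain ⟨B, h1, h2, h3⟩ := h
    have hi := integrable_risk hV hV0 hΦ hB hS (law ρ m) ρ h1 h2
    refine ⟨hi.sub (integrable_const _), ?_⟩
    rw [integral_sub hi (integrable_const _)]
    simpa using h3
  rcases hg with rfl | rfl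
  · have hm : Measurable (fun q : (Fin m → X × Y) × (ℕ → Fin m) =>
        avgIterate V Φ (fun _ => η) q.1 q.2 t) := by
      simp only [avgIterate_eq hη.ne']
      exact Finset.measurable_sum _ fun k _ => (hW k).const_smul _
    have hbd : ∀ q : (Fin m → X × Y) × (ℕ → Fin m), ‖avgIterate V Φ (fun _ => η) q.1 q.2 t‖ ≤
        ∑ k ∈ Finset.Icc 1 t, ‖(t : ℝ)⁻¹‖ * (k * (η * (a₀ * κ))) := fun q => by
      rw [avgIterate_eq hη.ne']
      refine (norm_sum_le _ _).trans (Finset.sum_le_sum fun k _ => ?_)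
      rw [norm_smul]
      exact mul_le_mul_of_nonneg_left (hWB k q) (norm_nonneg _)
    refine ⟨_, hm, hbd, le_trans (sub_le_sub_right ?_ _)
      ((average_expRisk_sub_infRisk_le hV hV0 hΦ hB hS hη hηL ht).trans hb)⟩
    exact integral_risk_average_le hV hV0 hΦ hB hS hη.le ht hm hbd
      fun q => avgIterate_eq hη.ne' _ _ _
  · exact ⟨_, hW t, hWB t, (expRisk_sub_infRisk_le hV hV0 hΦ hB hS hη hηL ht).trans hb⟩

end ExcessRisk

/-! ### Explicit rates and the stopping time -/

section Rates

/-- The rate `t log t / √(m³) + log t / √m + (√m / t) ^ β`. -/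
def rate (β : ℝ) (m t : ℕ) : ℝ :=
  (t : ℝ) * Real.log t / √((m : ℝ) ^ 3) + Real.log t / √(m : ℝ) + (√(m : ℝ) / t) ^ β

lemma rate_nonneg (β : ℝ) (m t : ℕ) : 0 ≤ rate β m t := by
  have := Real.log_natCast_nonneg t
  unfold rate
  positivity

lemma sqrt_natCast_cube (m : ℕ) : √((m : ℝ) ^ 3) = m * √(m : ℝ) := by
  rw [pow_succ, Real.sqrt_mul (by positivity), Real.sqrt_sq (by positivity)]

lemma error_terms_le_rate {β c η₁ G : ℝ} (hβ : 0 < β) (hc : 0 ≤ c) (hη₁ : 0 < η₁) {m t : ℕ}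
    (hm : 1 ≤ m) (ht : 1 ≤ t) :
    2 * (η₁ / √(m : ℝ)) * G ^ 2 * (t / m) + η₁ / √(m : ℝ) * G ^ 2 / 2 * (2 + Real.log t) +
        c * (1 / (η₁ / √(m : ℝ) * t)) ^ β ≤
      (6 * η₁ * G ^ 2 + c * η₁ ^ (-β)) * rate β m t := by
  have hm1 : (1 : ℝ) ≤ m := by exact_mod_cast hm
  have hs1 : 1 ≤ √(m : ℝ) := Real.one_le_sqrt.2 hm1
  have ht1 : (1 : ℝ) ≤ t := by exact_mod_cast ht
  have hs0 : 0 < √(m : ℝ) := by linarith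
  have hlog := Real.log_natCast_nonneg t
  have hP : 0 ≤ η₁ * G ^ 2 := by positivity
  have h1 : c * (1 / (η₁ / √(m : ℝ) * t)) ^ β = c * η₁ ^ (-β) * (√(m : ℝ) / t) ^ β := by
    rw [mul_assoc, Real.rpow_neg hη₁.le, ← Real.inv_rpow hη₁.le,
      ← Real.mul_rpow (by positivity) (by positivity)]
    congr 2
    field_simp
  have h2 : (t : ℝ) / (m * √(m : ℝ)) + 1 / √(m : ℝ) + Real.log t / √(m : ℝ) ≤
      3 * rate β m t := by
    rw [rate, sqrt_natCast_cube]
    -- At `t = 1` the logarithms vanish and only `√m ^ β ≥ 1` can absorb the other terms; for `t ≥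
    -- 2` they are absorbed using `Real.log t ≥ 1 / 2`.
    rcases ht.eq_or_lt with rfl | ht2
    · have h3 : 1 ≤ √(m : ℝ) ^ β := Real.one_le_rpow hs1 hβ.le
      have h4 : 1 / √(m : ℝ) ≤ 1 := (div_le_one hs0).2 hs1
      have h5 : 1 / (m * √(m : ℝ)) ≤ 1 := (div_le_one (by positivity)).2 (by nlinarith)
      simp only [Nat.cast_one, Real.log_one, mul_zero, zero_div, zero_add, div_one, add_zero]
      linarith
    · have h3 : 1 / 2 ≤ Real.log t := by
        have := Real.log_le_log (by norm_num) (by exact_mod_cast ht2 : (2 : ℝ) ≤ t)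
        linarith [Real.log_two_gt_d9]
      have h4 : (t : ℝ) / (m * √(m : ℝ)) ≤ 2 * (t * Real.log t / (m * √(m : ℝ))) := by
        rw [← mul_div_assoc]
        gcongr
        nlinarith
      have h5 : 1 / √(m : ℝ) ≤ 2 * (Real.log t / √(m : ℝ)) := by
        rw [← mul_div_assoc]
        gcongr
        linarith
      have h6 : 0 ≤ (√(m : ℝ) / t) ^ β := by positivity
      have h7 : 0 ≤ (t : ℝ) * Real.log t / (m * √(m : ℝ)) := by positivity
      linarith
  have h7 : 2 * (η₁ / √(m : ℝ)) * G ^ 2 * (t / m) +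
      η₁ / √(m : ℝ) * G ^ 2 / 2 * (2 + Real.log t) =
      η₁ * G ^ 2 * (2 * (t / (m * √(m : ℝ))) + 1 / √(m : ℝ) + Real.log t / √(m : ℝ) / 2) := by
    field_simp
    ring
  have h8 : 2 * (t / (m * √(m : ℝ))) + 1 / √(m : ℝ) + Real.log t / √(m : ℝ) / 2 ≤
      6 * rate β m t := by
    have : 0 ≤ 1 / √(m : ℝ) := by positivity
    have : 0 ≤ Real.log t / √(m : ℝ) := by positivity
    linarith
  have h9 : (√(m : ℝ) / t) ^ β ≤ rate β m t := by
    rw [rate]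
    exact le_add_of_nonneg_left (by positivity)
  rw [h1, h7]
  have h10 := mul_le_mul_of_nonneg_left h8 hP
  have h11 := mul_le_mul_of_nonneg_left h9 (by positivity : 0 ≤ c * η₁ ^ (-β))
  linarith

/-- The exponent `θ` solves `θ - 3 / 2 = (1 / 2 - θ) * β`, so the first and third terms of the rate
have the common order `m ^ (-γ)` up to logarithms. The middle term is no larger because `γ ≤ 1 / 2`,
which is where `β ≤ 1` enters. The three terms contribute 6, 3 and 2 to the constant 11. -/
lemma rate_ceil_le {β : ℝ} (hβ : 0 < β) (hβ1 : β ≤ 1) {m : ℕ} (hm : 2 ≤ m) :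
    rate β m ⌈(m : ℝ) ^ ((β + 3) / (2 * (β + 1)))⌉₊ ≤
      11 * ((m : ℝ) ^ (-(β / (β + 1))) * Real.log m) := by
  set θ := (β + 3) / (2 * (β + 1)) with hθ
  set γ := β / (β + 1) with hγ
  have hm2 : (2 : ℝ) ≤ m := by exact_mod_cast hm
  have hm0 : (0 : ℝ) < m := by linarith
  have hm1 : (1 : ℝ) ≤ m := by linarith
  set M : ℝ := (m : ℝ) ^ θ with hM
  set t := ⌈M⌉₊ with ht
  have hθ1 : θ = 3 / 2 - γ := by rw [hθ, hγ]; field_simp; ring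
  have hθβ : (1 / 2 - θ) * β = -γ := by rw [hθ, hγ]; field_simp; ring
  have hγ0 : 0 < γ := by positivity
  have hγ1 : γ ≤ 1 / 2 := by rw [hγ, div_le_div_iff₀ (by linarith) (by norm_num)]; linarith
  have hM1 : 1 ≤ M := Real.one_le_rpow hm1 (by linarith)
  have htM : M ≤ t := Nat.le_ceil M
  have htM2 : (t : ℝ) ≤ 2 * M := by
    have := Nat.ceil_lt_add_one (by linarith : 0 ≤ M)
    linarith
  have ht0 : (0 : ℝ) < t := by linarith
  have hlogm : 1 / 2 ≤ Real.log m := by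
    have := Real.log_le_log (by norm_num) hm2
    linarith [Real.log_two_gt_d9]
  have hlogt : Real.log t ≤ 3 * Real.log m := by
    have h1 := Real.log_le_log ht0 htM2
    have h2 := Real.log_le_log (by norm_num) hm2
    rw [Real.log_mul (by norm_num) (by positivity), hM, Real.log_rpow hm0] at h1
    nlinarith
  have hsqrt : √(m : ℝ) = (m : ℝ) ^ (1 / 2 : ℝ) := Real.sqrt_eq_rpow _
  have hcube : √((m : ℝ) ^ 3) = (m : ℝ) ^ (3 / 2 : ℝ) := by
    rw [Real.sqrt_eq_rpow, ← Real.rpow_natCast, ← Real.rpow_mul hm0.le]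
    norm_num
  have hg0 : 0 < (m : ℝ) ^ (-γ) := by positivity
  have e1 : (t : ℝ) * Real.log t / √((m : ℝ) ^ 3) ≤ 6 * ((m : ℝ) ^ (-γ) * Real.log m) := by
    rw [hcube, div_le_iff₀ (by positivity)]
    have : (m : ℝ) ^ (-γ) * (m : ℝ) ^ (3 / 2 : ℝ) = M := by
      rw [← Real.rpow_add hm0, hM, hθ1]; ring_nf
    calc (t : ℝ) * Real.log t ≤ 2 * M * (3 * Real.log m) :=
          mul_le_mul htM2 hlogt (Real.log_natCast_nonneg t) (by positivity)
      _ = 6 * ((m : ℝ) ^ (-γ) * Real.log m) * (m : ℝ) ^ (3 / 2 : ℝ) := by rw [← this]; ring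
  have e2 : Real.log t / √(m : ℝ) ≤ 3 * ((m : ℝ) ^ (-γ) * Real.log m) := by
    rw [hsqrt, div_eq_mul_inv, ← Real.rpow_neg hm0.le]
    calc Real.log t * (m : ℝ) ^ (-(1 / 2) : ℝ) ≤ 3 * Real.log m * (m : ℝ) ^ (-γ) :=
          mul_le_mul hlogt (Real.rpow_le_rpow_of_exponent_le hm1 (by linarith)) (by positivity)
            (by linarith)
      _ = _ := by ring
  have e3 : (√(m : ℝ) / t) ^ β ≤ 2 * ((m : ℝ) ^ (-γ) * Real.log m) := by
    calc (√(m : ℝ) / t) ^ β ≤ (√(m : ℝ) / M) ^ β := by gcongr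
      _ = (m : ℝ) ^ (-γ) := by
          rw [hsqrt, hM, ← Real.rpow_sub hm0, ← Real.rpow_mul hm0.le, hθβ]
      _ ≤ _ := by nlinarith
  rw [rate]
  linarith

end Rates

end SGM

end
theorem corollary1 (κ a₀ c β η₁ : ℝ) (hη₁ : 0 < η₁) :
    ∃ C : ℝ, 0 < C ∧
      ∀ (X : Type u) [MeasurableSpace X]
        (F : Type v) [NormedAddCommGroup F] [InnerProductSpace ℝ F] [CompleteSpace F]
        [TopologicalSpace.SeparableSpace F] [MeasurableSpace F] [BorelSpace F]
        (Y : Set ℝ) (ρ : Measure (X × Y)) [IsProbabilityMeasure ρ]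
        (V : ℝ → ℝ → ℝ) (Φ : X → F) (L : ℝ),
        Measurable (Function.uncurry V) → (∀ y a, 0 ≤ V y a) → Measurable Φ →
        SGM.BoundedAssumption Y V Φ κ a₀ →
        SGM.ApproxAssumption ρ V Φ β c →
        SGM.SmoothAssumption Y V L →
        η₁ * (κ ^ 2 * L) ≤ 2 →
        ∀ (m : ℕ) [NeZero m]
          (g : (Fin m → X × Y) → (ℕ → Fin m) → ℕ → F),
          (g = SGM.avgIterate V Φ (fun _ => η₁ / √(m : ℝ)) ∨
            g = SGM.iterate V Φ (fun _ => η₁ / √(m : ℝ))) →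
          (∀ t : ℕ, 1 ≤ t →
            SGM.ExpectedExcessRiskLE ρ V Φ m (fun z j => g z j t)
              (C * ((t : ℝ) * Real.log t / √((m : ℝ) ^ 3) + Real.log t / √(m : ℝ) +
                (√(m : ℝ) / t) ^ β))) ∧
          (2 ≤ m →
            SGM.ExpectedExcessRiskLE ρ V Φ m
              (fun z j => g z j ⌈(m : ℝ) ^ ((β + 3) / (2 * (β + 1)))⌉₊)
              (C * ((m : ℝ) ^ (-(β / (β + 1))) * Real.log m))) := by
  -- The constant is chosen before the assumptions on the problem, so the sign of `c` is not yet
  -- known; `|c|` and the added 1 ensure positivity. The factor 11 below is the one lost at the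
  -- stopping time.
  set C₁ : ℝ := 6 * η₁ * (a₀ * κ) ^ 2 + |c| * η₁ ^ (-β) + 1 with hC₁
  have hC₁0 : 0 < C₁ := by positivity
  refine ⟨11 * C₁, by positivity, ?_⟩
  intro X _ F _ _ _ _ _ _ Y ρ _ V Φ L hV hV0 hΦ hB hA hS hL m _ g hg
  have : SecondCountableTopology F := UniformSpace.secondCountable_of_separable F
  have hm : 1 ≤ m := NeZero.one_le
  have hs1 : 1 ≤ √(m : ℝ) := Real.one_le_sqrt.2 (by exact_mod_cast hm)
  have hη : 0 < η₁ / √(m : ℝ) := by positivity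
  have hηL : η₁ / √(m : ℝ) * (κ ^ 2 * L) ≤ 2 :=
    (mul_le_mul_of_nonneg_right (div_le_self hη₁.le hs1)
      (mul_nonneg (sq_nonneg _) hS.L_pos.le)).trans hL
  have key : ∀ t : ℕ, 1 ≤ t → ∀ b, C₁ * SGM.rate β m t ≤ b →
      SGM.ExpectedExcessRiskLE ρ V Φ m (fun z j => g z j t) b := by
    intro t ht b hb
    refine SGM.expectedExcessRiskLE_of_le hV hV0 hΦ hB hS hη hηL ht hg (le_trans ?_ hb)
    have h1 := hA.decay (1 / (η₁ / √(m : ℝ) * t)) (by positivity)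
    have h2 := SGM.error_terms_le_rate (G := a₀ * κ) hA.β_pos hA.c_pos.le hη₁ hm ht
    have h3 := SGM.rate_nonneg β m t
    rw [hC₁, abs_of_pos hA.c_pos]
    linarith
  refine ⟨fun t ht => key t ht _ ?_, fun hm2 => key _ ?_ _ ?_⟩
  · exact mul_le_mul_of_nonneg_right (by linarith) (SGM.rate_nonneg β m t)
  · exact Nat.one_le_iff_ne_zero.2 (Nat.ceil_pos.2 (by positivity)).ne'
  · calc C₁ * _ ≤ C₁ * _ :=
          mul_le_mul_of_nonneg_left (SGM.rate_ceil_le hA.β_pos hA.β_le_one hm2) hC₁0.le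
      _ = _ := by ring
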